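/- Let $\mathbf A$ be a finite algebra (a finite set $A$ with a possibly infinite family of finitary operations) that has a Mal'cev term, i.e. a ternary term $t$ with $t(y,x,x)=t(x,x,y)=y$ for all $x,y\in A$, and fix an arbitrary element $0\in A$. A polynomial over $\mathbf A$ is a term built from variables and elements of $A$ using the operation symbols of $\mathbf A$. For congruences $\alpha_1,\dots,\alpha_n$ of $\mathbf A$ let $[\alpha_1,\dots,\alpha_n]$ denote the smallest congruence $\delta$ of $\mathbf A$ with the following property: for every polynomial $f(\bar x_1,\dots,\bar x_n)$ in $n$ blocks of variables and all tuples $\bar a_i,\bar b_i$ over $A$ with $\bar a_i\equiv_{\alpha_i}\bar b_i$ componentwise $(1\le i\le n)$, writing $\bar c_i^{\,S}=\bar b_i$ for $i\in S$ and $\bar c_i^{\,S}=\bar a_i$ for $i\notin S$, if $$f(\bar a_1,\bar c_2^{\,S},\dots,\bar c_n^{\,S})\equiv_\delta f(\bar b_1,\bar c_2^{\,S},\dots,\bar c_n^{\,S})\quad\text{for all } S\subsetneq\{2,\dots,n\},$$ then $f(\bar a_1,\bar b_2,\dots,\bar b_n)\equiv_\delta f(\bar b_1,\bar b_2,\dots,\bar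 b_n)$. The algebra $\mathbf A$ is called supernilpotent if there is an $n \ge 0$ such that $[\mathbf 1_{\mathbf A},\dots,\mathbf 1_{\mathbf A}]=\mathbf 0_{\mathbf A}$ with $n+1$ entries, where $\mathbf 1_{\mathbf A}$ is the total relation and $\mathbf 0_{\mathbf A}$ the identity relation on $A$. For $\bar r\in A^m$ and $T\subseteq\{1,\dots,m\}$ let $\bar r_T\in A^m$ be the tuple whose $i$-th entry is $r_i$ if $i\in T$ and $0$ otherwise. Then $\mathbf A$ is supernilpotent if and only if there is a positive integer $d$ such that for every $m\ge 0$, every polynomial $f(x_1,\dots,x_m)$ over $\mathbf A$ and every tuple $\bar r\in A^m$ there is an index set $T\subseteq\{1,\dots,m\}$ with $|T|\le d$ and $f(\bar r)=f(\bar r_T)$. -/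

import Mathlib

namespace UnivAlg

open FirstOrder.Language

universe u v w x

/-- A polynomial over the algebra `A` in the variables `ι`: a term built from variables and
elements of `A` using the operation symbols of `L`. -/
abbrev PolyTerm (L : FirstOrder.Language.{u, v}) (A : Type w) (ι : Type x) := (L.withConstants A).Term ι

/-- The value of a polynomial at a tuple of elements of `A`. -/
def PolyTerm.value {L : FirstOrder.Language.{u, v}} {A : Type w} [L.Structure A] {ι : Type x}
    (f : PolyTerm L A ι) (r : ι → A) : A :=
  Term.realize r f

/-- The algebra `A` has a Mal'cev term: a ternary term `t` (without parameters) with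
`t(y, x, x) = t(x, x, y) = y` for all `x, y`. -/
def HasMalcevTerm (L : FirstOrder.Language.{u, v}) (A : Type w) [L.Structure A] : Prop :=
  ∃ t : L.Term (Fin 3), ∀ x y : A,
    t.realize ![y, x, x] = y ∧ t.realize ![x, x, y] = y

/-- An equivalence relation is a congruence if it is preserved by all basic operations. -/
def IsCongruence (L : FirstOrder.Language.{u, v}) {A : Type w} [L.Structure A] (δ : Setoid A) : Prop :=
  ∀ (n : ℕ) (g : L.Functions n) (x y : Fin n → A),
    (∀ i, δ (x i) (y i)) → δ (Structure.funMap g x) (Structure.funMap g y)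

/-- For blocks `a i`, `b i` of variables, the corner of the cube `∏ i, {a i, b i}` at which the
block `b i` is chosen for `i ∈ S` and the block `a i` for `i ∉ S`. -/
def corner {A : Type w} {n : ℕ} {k : Fin n → ℕ} (a b : (i : Fin n) → Fin (k i) → A)
    (S : Finset (Fin n)) : (Σ i, Fin (k i)) → A :=
  fun p => if p.1 ∈ S then b p.1 p.2 else a p.1 p.2

/-- The term condition defining the higher commutator `[α 0, …, α n]`. The first block of variables
is the one with index `0`. For every choice `S` of corners of the remaining blocks other than the
choice of `b i` throughout, the values at `a 0` and at `b 0` are assumed to be `δ`-related; then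
the values at `a 0` and at `b 0` are `δ`-related for the choice of `b i` throughout. -/
def TermCondition (L : FirstOrder.Language.{u, v}) {A : Type w} [L.Structure A] {n : ℕ}
    (α : Fin (n + 1) → Setoid A) (δ : Setoid A) : Prop :=
  ∀ (k : Fin (n + 1) → ℕ) (f : PolyTerm L A (Σ i, Fin (k i)))
    (a b : (i : Fin (n + 1)) → Fin (k i) → A),
    (∀ i j, α i (a i j) (b i j)) →
    (∀ S : Finset (Fin (n + 1)), S ⊂ Finset.univ.erase 0 →
      δ (f.value (corner a b S)) (f.value (corner a b (insert 0 S)))) →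
    δ (f.value (corner a b (Finset.univ.erase 0)))
      (f.value (corner a b (insert 0 (Finset.univ.erase 0))))

/-- The higher commutator `[α 0, …, α n]`, see `isLeast_higherCommutator`. -/
def higherCommutator (L : FirstOrder.Language.{u, v}) {A : Type w} [L.Structure A] {n : ℕ}
    (α : Fin (n + 1) → Setoid A) : Setoid A :=
  sInf {δ | IsCongruence L δ ∧ TermCondition L α δ}

/-- The higher commutator is the smallest congruence that satisfies the term condition. -/
theorem isLeast_higherCommutator (L : FirstOrder.Language.{u, v}) {A : Type w} [L.Structure A] {n : ℕ}
    (α : Fin (n + 1) → Setoid A) :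
    IsLeast {δ | IsCongruence L δ ∧ TermCondition L α δ} (higherCommutator L α) := by
  refine ⟨⟨?_, ?_⟩, fun δ hδ => sInf_le hδ⟩
  · intro n g x y h δ hδ
    exact hδ.1 n g x y fun i => h i δ hδ
  · intro k f a b hab h δ hδ
    exact hδ.2 k f a b hab fun S hS => h S hS δ hδ

/-- `A` is supernilpotent of degree `n`: the commutator of `n + 1` copies of the total relation is
the identity relation. -/
def SupernilpotentOfDegree (L : FirstOrder.Language.{u, v}) (A : Type w) [L.Structure A] (n : ℕ) : Prop :=
  higherCommutator L (fun _ : Fin (n + 1) => (⊤ : Setoid A)) = ⊥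

/-- `A` is supernilpotent (of some degree). -/
def Supernilpotent (L : FirstOrder.Language.{u, v}) (A : Type w) [L.Structure A] : Prop :=
  ∃ n : ℕ, SupernilpotentOfDegree L A n

/-- The tuple `r_T`, which agrees with `r` on `T` and is equal to `z` elsewhere. -/
def restrictTo {A : Type w} {m : ℕ} (z : A) (r : Fin m → A) (T : Finset (Fin m)) : Fin m → A :=
  fun i => if i ∈ T then r i else z

end UnivAlg

/-! Supernilpotent implies bounded: choose `T` minimal with f(r) = f(r_T). If `T` is large, colour
each subset of it by the value of f after resetting that subset to `z`. The finite unions theorem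
gives n + 1 disjoint nonempty sets all of whose nonempty unions have one colour c. These span a cube
on which f equals c except perhaps at r_T, so the term condition forces f(r_T) = c, and one of the
sets can be dropped from `T`. Bounded implies supernilpotent: with the Mal'cev term, an instance of
the term condition is turned into a polynomial that takes a fixed value e as soon as one of d + 1
blocks equals its a-block. Dependence on at most d entries leaves some block free, so the value at
the b-corner is e too. -/

namespace Combinatorics

/-! ### Finite unions theorem from Hales–Jewett -/

/-- For every finite colouring of the subsets of a suitable finite set there are `k` disjoint
nonempty sets for which the colour of a nonempty union depends only on its least index. -/
theorem exists_disjoint_sets_color_union_eq_of_isLeast (κ : Type*) [Finite κ] (k : ℕ) :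
    ∃ (ι : Type) (_ : Fintype ι), ∀ C : Set ι → κ, ∃ U : Fin k → Set ι,
      (∀ i, (U i).Nonempty) ∧ Pairwise (fun i j => Disjoint (U i) (U j)) ∧
      ∃ g : Fin k → κ, ∀ (I : Set (Fin k)) (i : Fin k), IsLeast I i → C (⋃ j ∈ I, U j) = g i := by
  classical
  induction k with
  | zero =>
    exact ⟨Empty, inferInstance, fun _ => ⟨Fin.elim0, fun i => i.elim0, fun i => i.elim0,
      Fin.elim0, fun _ i => i.elim0⟩⟩
  | succ k ih =>
    obtain ⟨ι', _, ih⟩ := ih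
    obtain ⟨ι, _, hι⟩ := Line.exists_mono_in_high_dimension (Set (Option ι')) κ
    -- A word of length `ι` over the alphabet `Set (Option ι')` is a subset of `ι × Option ι'`.
    refine ⟨ι × Option ι', inferInstance, fun C => ?_⟩
    obtain ⟨l, c, hl⟩ := hι fun x => C {p | p.2 ∈ x p.1}
    obtain ⟨i₀, hi₀⟩ := l.proper
    let E : Set ι' → Set (ι × Option ι') := fun W => {p | l.idxFun p.1 = none ∧ ∃ o ∈ W, p.2 = some o}
    obtain ⟨U, hne, hdisj, g, hg⟩ := ih fun W => C (E W)
    -- The letter `none` makes `V` nonempty and disjoint from every `E W`. Each `V ∪ E W` is the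
    -- point of `l` at `{none} ∪ some '' W`, so it has colour `c`; `V` thus serves as the set of
    -- least index.
    let V : Set (ι × Option ι') := {p | p.2 ∈ l {none} p.1}
    have hV : ∀ W, Disjoint V (E W) := by
      intro W
      rw [Set.disjoint_left]
      rintro ⟨i, o⟩ hp ⟨hi, o', -, ho⟩
      simp only at hi ho
      simp [V, hi, ho] at hp
    have hE : ∀ I : Set (Fin k), ⋃ j ∈ I, E (U j) = E (⋃ j ∈ I, U j) := by
      intro I
      ext p
      simp only [E, Set.mem_iUnion, Set.mem_ofPred_eq]
      grind
    refine ⟨Fin.cons V fun i => E (U i), ?_, ?_, Fin.cons c g, ?_⟩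
    · refine Fin.cases ⟨(i₀, none), by simp [V, hi₀]⟩ fun i => ?_
      obtain ⟨o, ho⟩ := hne i
      exact ⟨(i₀, some o), hi₀, o, ho, rfl⟩
    · refine Fin.cases (Fin.cases (fun h => (h rfl).elim) fun j _ => hV _) fun i => ?_
      refine Fin.cases (fun _ => (hV _).symm) fun j hij => ?_
      have := hdisj (fun h : i = j => hij (congrArg Fin.succ h))
      simp only [Fin.cons_succ, Set.disjoint_left] at this ⊢
      rintro ⟨a, b⟩ ⟨-, o, ho, h1⟩ ⟨-, o', ho', h2⟩
      obtain rfl : o = o' := Option.some_injective _ (h1.symm.trans h2)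
      exact this ho ho'
    · intro I i hI
      cases i using Fin.cases with
      | zero =>
        rw [Fin.cons_zero, ← hl ({none} ∪ some '' ⋃ j ∈ Fin.succ ⁻¹' I, U j)]
        congr 1
        ext ⟨a, b⟩
        have h0 := hI.1
        have hex : (∃ j ∈ I, (a, b) ∈ (Fin.cons V (fun i => E (U i)) : Fin (k + 1) → Set _) j) ↔
            (a, b) ∈ V ∨ ∃ j, j.succ ∈ I ∧ (a, b) ∈ E (U j) := by
          rw [Fin.exists_fin_succ]
          simp [h0]
        simp only [Set.mem_iUnion, exists_prop, hex]
        cases h : l.idxFun a with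
        | none =>
          simp only [V, E, h, Set.mem_ofPred_eq, Line.coe_apply, Option.getD_none]
          simp
          grind
        | some x => simp [V, E, h]
      | succ i =>
        rw [Fin.cons_succ, ← hg (Fin.succ ⁻¹' I) i
          ⟨hI.1, fun j hj => Fin.succ_le_succ_iff.1 (hI.2 hj)⟩, ← hE]
        congr 1
        ext p
        have h0 : (0 : Fin (k + 1)) ∉ I := fun h => by simpa using hI.2 h
        simp only [Set.mem_iUnion, exists_prop]
        rw [Fin.exists_fin_succ]
        simp [h0]

/-- The finite unions theorem: for every finite colouring of the subsets of a suitable finite set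
there are `n` disjoint nonempty sets all of whose nonempty unions have the same colour. -/
theorem exists_disjoint_sets_monochromatic_unions (κ : Type*) [Finite κ] (n : ℕ) :
    ∃ (ι : Type) (_ : Fintype ι), ∀ C : Set ι → κ, ∃ W : Fin n → Set ι,
      (∀ i, (W i).Nonempty) ∧ Pairwise (fun i j => Disjoint (W i) (W j)) ∧
      ∃ c, ∀ I : Set (Fin n), I.Nonempty → C (⋃ i ∈ I, W i) = c := by
  classical
  have := Fintype.ofFinite κ
  obtain ⟨ι, _, hι⟩ :=
    exists_disjoint_sets_color_union_eq_of_isLeast κ (Fintype.card κ * n + 1)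
  refine ⟨ι, inferInstance, fun C => ?_⟩
  obtain ⟨U, hne, hdisj, g, hg⟩ := hι C
  -- Inside one fibre of `g` the least index no longer affects the colour.
  obtain ⟨c, hc⟩ := Fintype.exists_lt_card_fiber_of_mul_lt_card g (n := n) (by simp)
  let e := (Finset.univ.filter fun i => g i = c).orderEmbOfCardLe hc.le
  have he : ∀ i, g (e i) = c := fun i =>
    (Finset.mem_filter.1 (Finset.orderEmbOfCardLe_mem _ hc.le i)).2
  refine ⟨fun i => U (e i), fun i => hne _, fun i j hij => hdisj (e.injective.ne hij), c, ?_⟩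
  intro I hI
  obtain ⟨i, hi⟩ := I.toFinite.exists_minimal hI
  have hle : IsLeast I i := ⟨hi.1, fun j hj => (le_total i j).elim id (hi.2 hj)⟩
  rw [← he i, ← hg (e '' I) (e i)]
  · simp
  · exact ⟨⟨i, hle.1, rfl⟩, by rintro _ ⟨j, hj, rfl⟩; exact e.monotone (hle.2 hj)⟩

end Combinatorics

namespace UnivAlg

open FirstOrder FirstOrder.Language

/-! ### Closure properties of polynomial functions -/

section PolynomialFunctions

variable {L : FirstOrder.Language.{u, v}} {A : Type w} [L.Structure A] {ι κ : Type*}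

variable (L) in
/-- A polynomial function is the function induced by a polynomial. -/
def IsPolynomialFunction (F : (ι → A) → A) : Prop :=
  ∃ p : PolyTerm L A ι, ∀ x, p.value x = F x

theorem isPolynomialFunction_value (p : PolyTerm L A ι) :
    IsPolynomialFunction L fun x => p.value x :=
  ⟨p, fun _ => rfl⟩

theorem isPolynomialFunction_proj (i : ι) : IsPolynomialFunction L fun x : ι → A => x i :=
  ⟨Term.var i, fun _ => rfl⟩

theorem isPolynomialFunction_const (a : A) : IsPolynomialFunction L fun _ : ι → A => a :=
  ⟨(L.con a).term, fun _ => Term.realize_constants.trans rfl⟩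

theorem isPolynomialFunction_realize (t : L.Term ι) :
    IsPolynomialFunction L fun x : ι → A => t.realize x :=
  ⟨(L.lhomWithConstants A).onTerm t, fun x => LHom.realize_onTerm _ t x⟩

theorem IsPolynomialFunction.comp {F : (ι → A) → A} (hF : IsPolynomialFunction L F)
    {G : ι → (κ → A) → A} (hG : ∀ i, IsPolynomialFunction L (G i)) :
    IsPolynomialFunction L fun x => F fun i => G i x := by
  obtain ⟨p, hp⟩ := hF
  choose q hq using hG
  refine ⟨p.subst q, fun x => ?_⟩
  refine Term.realize_subst.trans (Eq.trans ?_ (hp _))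
  exact congrArg p.value (funext fun i => hq i x)

theorem IsPolynomialFunction.ternary (t : L.Term (Fin 3)) {F G H : (ι → A) → A}
    (hF : IsPolynomialFunction L F) (hG : IsPolynomialFunction L G)
    (hH : IsPolynomialFunction L H) :
    IsPolynomialFunction L fun x => t.realize ![F x, G x, H x] := by
  have h := (isPolynomialFunction_realize (A := A) t).comp (G := ![F, G, H])
    (by simp [Fin.forall_fin_succ, hF, hG, hH])
  convert h using 3 with x
  ext i
  fin_cases i <;> rfl

end PolynomialFunctions

/-! ### Absorbing polynomials from the Mal'cev term -/

section Absorbing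

variable {L : FirstOrder.Language.{u, v}} {A : Type w} [L.Structure A] {n : ℕ} {k : Fin n → ℕ}

/-- The tuple obtained from `x` by replacing the block with index `i` by the block `a i`. -/
def resetBlock (a : (i : Fin n) → Fin (k i) → A) (i : Fin n) (x : (Σ i, Fin (k i)) → A) :
    (Σ i, Fin (k i)) → A :=
  fun p => if p.1 = i then a p.1 p.2 else x p

theorem isPolynomialFunction_resetBlock (a : (i : Fin n) → Fin (k i) → A) (i : Fin n)
    (p : Σ i, Fin (k i)) : IsPolynomialFunction L fun x => resetBlock a i x p := by
  by_cases h : p.1 = i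
  · simpa [resetBlock, h] using isPolynomialFunction_const (L := L) (a p.1 p.2)
  · simpa [resetBlock, h] using isPolynomialFunction_proj (L := L) (A := A) p

theorem resetBlock_eq_self {a : (i : Fin n) → Fin (k i) → A} {i : Fin n}
    {x : (Σ i, Fin (k i)) → A} (h : ∀ j, x ⟨i, j⟩ = a i j) : resetBlock a i x = x := by
  funext p
  obtain ⟨i', j⟩ := p
  by_cases hi : i' = i
  · subst hi
    simp [resetBlock, h]
  · simp [resetBlock, hi]

theorem resetBlock_apply_of_eq {a : (i : Fin n) → Fin (k i) → A} (i : Fin n) {i' : Fin n}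
    {x : (Σ i, Fin (k i)) → A} (h : ∀ j, x ⟨i', j⟩ = a i' j) (j : Fin (k i')) :
    resetBlock a i x ⟨i', j⟩ = a i' j := by
  simp [resetBlock, h]

theorem resetBlock_corner (a b : (i : Fin n) → Fin (k i) → A) (i : Fin n) (S : Finset (Fin n)) :
    resetBlock a i (corner a b S) = corner a b (S.erase i) := by
  funext p
  by_cases hi : p.1 = i <;> simp [resetBlock, corner, hi]

theorem corner_univ (a b : (i : Fin n) → Fin (k i) → A) (p : Σ i, Fin (k i)) :
    corner a b Finset.univ p = b p.1 p.2 := by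
  simp [corner]

/-- Block by block, G is replaced by t(G(x), G(x with block i reset to `a i`), e). If block i of x
already is `a i`, this is t(u, u, e) = e. At the top corner the reset gives e, so t(u, e, e) = u
keeps the value. Block 0 goes first because `hcube` compares corners only in that direction. -/
theorem exists_absorbing_polynomialFunction {t : L.Term (Fin 3)}
    (ht : ∀ x y : A, t.realize ![y, x, x] = y ∧ t.realize ![x, x, y] = y)
    {n : ℕ} {k : Fin (n + 1) → ℕ} {F : ((Σ i, Fin (k i)) → A) → A}
    (hF : IsPolynomialFunction L F) (a b : (i : Fin (n + 1)) → Fin (k i) → A)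
    (hcube : ∀ S : Finset (Fin (n + 1)), S ⊂ Finset.univ.erase 0 →
      F (corner a b S) = F (corner a b (insert 0 S))) (s : Finset (Fin (n + 1))) :
    ∃ G : ((Σ i, Fin (k i)) → A) → A, IsPolynomialFunction L G ∧
      (∀ x, ∀ i ∈ insert 0 s, (∀ j, x ⟨i, j⟩ = a i j) →
        G x = F (corner a b (Finset.univ.erase 0))) ∧
      (∀ S ≠ Finset.univ, G (corner a b S) = F (corner a b (Finset.univ.erase 0))) ∧
      G (corner a b Finset.univ) = F (corner a b Finset.univ) := by
  set e := F (corner a b (Finset.univ.erase 0)) with he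
  have hreset : ∀ {G : ((Σ i, Fin (k i)) → A) → A}, IsPolynomialFunction L G → ∀ i,
      IsPolynomialFunction L fun x => t.realize ![G x, G (resetBlock a i x), e] :=
    fun hG i => IsPolynomialFunction.ternary t hG
      (hG.comp fun p => isPolynomialFunction_resetBlock a i p) (isPolynomialFunction_const e)
  induction s using Finset.induction_on with
  | empty =>
    refine ⟨_, hreset hF 0, ?_, ?_, ?_⟩
    · intro x i hi hx
      obtain rfl : i = 0 := by simpa using hi
      simp only [resetBlock_eq_self hx, (ht _ _).2]
    · intro S hS
      simp only [resetBlock_corner]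
      by_cases h0 : (0 : Fin (n + 1)) ∈ S
      · have hss : S.erase 0 ⊂ Finset.univ.erase 0 := by
          refine (Finset.erase_subset_erase 0 (Finset.subset_univ S)).ssubset_of_ne fun h => hS ?_
          rw [← Finset.insert_erase h0, h, Finset.insert_erase (Finset.mem_univ _)]
        rw [hcube _ hss, Finset.insert_erase h0, (ht _ _).2]
      · rw [Finset.erase_eq_of_notMem h0, (ht _ _).2]
    · simp only [resetBlock_corner, ← he, (ht _ _).1]
  | insert i s _ ih =>
    obtain ⟨G, hG, habs, hcorner, htop⟩ := ih
    refine ⟨_, hreset hG i, ?_, ?_, ?_⟩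
    · intro x i' hi' hx
      by_cases hii : i' = i
      · subst hii
        simp only [resetBlock_eq_self hx, (ht _ _).2]
      · have hmem : i' ∈ insert 0 s := by
          simp only [Finset.mem_insert] at hi' ⊢
          tauto
        simp only [habs x i' hmem hx, habs _ i' hmem (resetBlock_apply_of_eq i hx), (ht _ _).2]
    · intro S hS
      have hne : S.erase i ≠ Finset.univ := fun h => 
        Finset.notMem_erase i _ (h.symm ▸ Finset.mem_univ i)
      simp only [resetBlock_corner, hcorner S hS, hcorner _ hne, (ht _ _).2]
    · have hne : (Finset.univ : Finset (Fin (n + 1))).erase i ≠ Finset.univ := fun h => 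
        Finset.notMem_erase i _ (h.symm ▸ Finset.mem_univ i)
      simp only [resetBlock_corner, htop, hcorner _ hne, (ht _ _).1]

end Absorbing

/-! ### The two implications -/

section Main

variable {L : FirstOrder.Language.{u, v}} {A : Type w} [L.Structure A]

/-- The bound on the size of `T` for polynomials in the variables `Fin m` yields the same bound for
polynomial functions in any finite set of variables. -/
theorem IsPolynomialFunction.exists_card_le {z : A} {d : ℕ}
    (hd : ∀ (m : ℕ) (f : PolyTerm L A (Fin m)) (r : Fin m → A),
      ∃ T : Finset (Fin m), T.card ≤ d ∧ f.value r = f.value (restrictTo z r T))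
    {ι : Type*} [Fintype ι] [DecidableEq ι] {F : (ι → A) → A} (hF : IsPolynomialFunction L F)
    (r : ι → A) :
    ∃ T : Finset ι, T.card ≤ d ∧ F r = F fun i => if i ∈ T then r i else z := by
  let e := Fintype.equivFin ι
  obtain ⟨p, hp⟩ := hF.comp fun i => isPolynomialFunction_proj (L := L) (A := A) (e i)
  obtain ⟨T, hT, h⟩ := hd _ p fun i => r (e.symm i)
  refine ⟨T.map e.symm.toEmbedding, by simpa using hT, ?_⟩
  rw [hp, hp] at h
  simpa [restrictTo] using h

theorem supernilpotentOfDegree_of_exists_card_le (hA : HasMalcevTerm L A) {z : A} {d : ℕ}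
    (hd : ∀ (m : ℕ) (f : PolyTerm L A (Fin m)) (r : Fin m → A),
      ∃ T : Finset (Fin m), T.card ≤ d ∧ f.value r = f.value (restrictTo z r T)) :
    SupernilpotentOfDegree L A d := by
  classical
  obtain ⟨t, ht⟩ := hA
  refine le_bot_iff.1 (sInf_le ⟨fun n g x y h => congrArg _ (funext h), ?_⟩)
  intro k f a b _ hcube
  obtain ⟨G, hG, habs, -, htop⟩ := exists_absorbing_polynomialFunction ht
    (isPolynomialFunction_value f) a b hcube Finset.univ
  -- Substituting t(y, y', a) moves the default from `z` to `a`: it gives b at (b, a), and t(z, z,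
  -- a) = a where both entries are reset.
  have hH := hG.comp (κ := (Σ i, Fin (k i)) ⊕ (Σ i, Fin (k i)))
    (G := fun p y => t.realize ![y (Sum.inl p), y (Sum.inr p), a p.1 p.2])
    fun p => IsPolynomialFunction.ternary t (isPolynomialFunction_proj _)
      (isPolynomialFunction_proj _) (isPolynomialFunction_const _)
  obtain ⟨T, hT, h⟩ := hH.exists_card_le hd
    (Sum.elim (fun p => b p.1 p.2) fun p => a p.1 p.2)
  let block : (Σ i, Fin (k i)) ⊕ (Σ i, Fin (k i)) → Fin (d + 1) := Sum.elim Sigma.fst Sigma.fst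
  -- At most d entries are kept and there are d + 1 blocks.
  obtain ⟨i, hi⟩ : ∃ i, i ∉ T.image block := by
    by_contra! hall
    have h1 := Finset.card_le_card (fun i _ => hall i : Finset.univ ⊆ T.image block)
    have h2 := Finset.card_image_le (s := T) (f := block)
    simp only [Finset.card_univ, Fintype.card_fin] at h1
    omega
  have hfree : ∀ q ∈ T, block q ≠ i := fun q hq h => hi (Finset.mem_image.2 ⟨q, hq, h⟩)
  have hcorner : (fun p : Σ i, Fin (k i) => b p.1 p.2) = corner a b Finset.univ :=
    funext fun p => (corner_univ a b p).symm
  simp only [Sum.elim_inl, Sum.elim_inr, (ht _ _).1] at h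
  rw [hcorner, htop, habs _ i (by simp)] at h
  · rw [Finset.insert_erase (Finset.mem_univ _)]
    exact h.symm
  · intro j
    have hl : (Sum.inl ⟨i, j⟩ : (Σ i, Fin (k i)) ⊕ (Σ i, Fin (k i))) ∉ T :=
      fun hm => hfree _ hm rfl
    have hr : (Sum.inr ⟨i, j⟩ : (Σ i, Fin (k i)) ⊕ (Σ i, Fin (k i))) ∉ T :=
      fun hm => hfree _ hm rfl
    simp only [hl, hr, if_false, (ht _ _).2]

/-- In a supernilpotent algebra, a polynomial that is constant on all corners of a cube other than
one has the same value at the remaining corner. -/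
theorem SupernilpotentOfDegree.value_eq_of_constant {n : ℕ} (hn : SupernilpotentOfDegree L A n)
    {m : ℕ} (f : PolyTerm L A (Fin m)) (r r' : Fin m → A) (W : Fin (n + 1) → Set (Fin m))
    (hW : Pairwise fun i j => Disjoint (W i) (W j)) {c : A} [∀ U : Set (Fin m), DecidablePred (· ∈ U)]
    (hc : ∀ I : Set (Fin (n + 1)), I.Nonempty →
      f.value (fun v => if v ∈ ⋃ i ∈ I, W i then r' v else r v) = c) :
    f.value r = c := by
  classical
  have htc := (isLeast_higherCommutator L fun _ : Fin (n + 1) => (⊤ : Setoid A)).1.2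
  rw [show higherCommutator L (fun _ : Fin (n + 1) => (⊤ : Setoid A)) = ⊥ from hn] at htc
  -- Each block is a full copy of the variables, of which block i uses only those in `W i`.
  obtain ⟨p, hp⟩ := (isPolynomialFunction_value f).comp (κ := Σ _ : Fin (n + 1), Fin m)
    (G := fun v x => if h : ∃ i, v ∈ W i then x ⟨h.choose, v⟩ else r v) (by
      intro v
      by_cases h : ∃ i, v ∈ W i
      · simpa only [h, dif_pos] using isPolynomialFunction_proj _
      · simpa only [h, dif_neg, not_false_eq_true] using isPolynomialFunction_const _)
  have hcorner : ∀ S : Finset (Fin (n + 1)), p.value (corner (fun _ => r') (fun _ => r) S) =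
      f.value (fun v => if v ∈ ⋃ i ∈ {i | i ∉ S}, W i then r' v else r v) := by
    intro S
    rw [hp]
    refine congrArg f.value (funext fun v => ?_)
    by_cases h : ∃ i, v ∈ W i
    · have huniq : ∀ i, v ∈ W i → i = h.choose := fun i hi => by
        by_contra hne
        exact Set.disjoint_left.1 (hW hne) hi h.choose_spec
      have hiff : v ∈ ⋃ i ∈ {i | i ∉ S}, W i ↔ h.choose ∉ S := by
        simp only [Set.mem_iUnion, Set.mem_ofPred_eq, exists_prop]
        exact ⟨fun ⟨i, hi, hv⟩ => huniq i hv ▸ hi, fun hi => ⟨_, hi, h.choose_spec⟩⟩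
      by_cases hS : h.choose ∈ S
      · rw [dif_pos h, if_neg (by rw [hiff]; exact not_not.2 hS)]
        simp only [corner, hS, if_true]
      · rw [dif_pos h, if_pos (hiff.2 hS)]
        simp only [corner, hS, if_false]
    · have hnot : v ∉ ⋃ i ∈ {i | i ∉ S}, W i := by
        simp only [Set.mem_iUnion, exists_prop]
        exact fun ⟨i, _, hv⟩ => h ⟨i, hv⟩
      rw [dif_neg h, if_neg hnot]
  have hconst : ∀ S : Finset (Fin (n + 1)), S ≠ Finset.univ →
      p.value (corner (fun _ => r') (fun _ => r) S) = c := by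
    intro S hS
    rw [hcorner]
    refine hc _ ?_
    by_contra hempty
    exact hS (Finset.eq_univ_of_forall fun i => by
      by_contra hi
      exact hempty ⟨i, hi⟩)
  -- The a-side is `r'` and the b-side `r`, so the exceptional top corner is `r` itself.
  have key : p.value _ = p.value _ := htc (fun _ => m) p (fun _ => r') (fun _ => r)
    (fun _ _ => trivial) fun S hS => by
    change p.value _ = p.value _
    rw [hconst, hconst]
    · intro h
      refine hS.not_subset fun i hi => ?_
      have := h ▸ Finset.mem_univ i
      exact (Finset.mem_insert.1 this).resolve_left (Finset.ne_of_mem_erase hi)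
    · rintro rfl
      simpa using hS.1 (Finset.mem_univ (0 : Fin (n + 1)))
  rw [hconst _ fun h => Finset.notMem_erase 0 _ (h.symm ▸ Finset.mem_univ (0 : Fin (n + 1))),
    Finset.insert_erase (Finset.mem_univ _), hcorner] at key
  simpa using key.symm

theorem SupernilpotentOfDegree.exists_card_le [Finite A] {n : ℕ}
    (hn : SupernilpotentOfDegree L A n) (z : A) :
    ∃ d : ℕ, 0 < d ∧ ∀ (m : ℕ) (f : PolyTerm L A (Fin m)) (r : Fin m → A),
      ∃ T : Finset (Fin m), T.card ≤ d ∧ f.value r = f.value (restrictTo z r T) := by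
  classical
  obtain ⟨ι, _, hι⟩ := Combinatorics.exists_disjoint_sets_monochromatic_unions A (n + 1)
  -- The summand 1 only makes the bound positive.
  refine ⟨Fintype.card ι + 1, Nat.succ_pos _, fun m f r => ?_⟩
  obtain ⟨T, hT, hmin⟩ := (Set.toFinite {T | f.value r = f.value (restrictTo z r T)}).exists_minimal
    ⟨Finset.univ, congrArg f.value (funext fun i => by simp [restrictTo])⟩
  refine ⟨T, ?_, hT⟩
  by_contra! hcard
  obtain ⟨e⟩ : Nonempty (ι ↪ T) :=
    Function.Embedding.nonempty_of_card_le (by rw [Fintype.card_coe]; omega)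
  let E : Set ι → Set (Fin m) := fun U => (fun i => (e i : Fin m)) '' U
  have hEinj : Function.Injective fun i => (e i : Fin m) := Subtype.val_injective.comp e.injective
  obtain ⟨W, hne, hdisj, c, hc⟩ := hι fun U =>
    f.value fun v => if v ∈ E U then z else restrictTo z r T v
  have hunion : ∀ I : Set (Fin (n + 1)), ⋃ i ∈ I, E (W i) = E (⋃ i ∈ I, W i) := fun I => by
    simp only [E, Set.image_iUnion]
  have hval : f.value (restrictTo z r T) = c :=
    hn.value_eq_of_constant f _ (fun _ => z) (fun i => E (W i))
      (fun i j hij => (Set.disjoint_image_iff hEinj).2 (hdisj hij)) fun I hI => by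
        rw [hunion]
        exact hc I hI
  obtain ⟨w, hw⟩ := hne 0
  have hT' : f.value r = f.value (restrictTo z r (T.filter fun v => v ∉ E (W 0))) := by
    rw [hT.out, hval, ← hc {0} (Set.singleton_nonempty 0)]
    congr 1
    funext v
    by_cases hv : v ∈ E (W 0) <;> simp [restrictTo, hv]
  have hmem := hmin hT' (Finset.filter_subset _ _) (e w).2
  exact (Finset.mem_filter.1 hmem).2 ⟨w, hw, rfl⟩

end Main

end UnivAlg

theorem corollary2p4 (L : FirstOrder.Language) [L.IsAlgebraic] (A : Type*) [L.Structure A]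
    [Finite A] (hA : UnivAlg.HasMalcevTerm L A) (z : A) :
    UnivAlg.Supernilpotent L A ↔
      ∃ d : ℕ, 0 < d ∧ ∀ (m : ℕ) (f : UnivAlg.PolyTerm L A (Fin m)) (r : Fin m → A),
        ∃ T : Finset (Fin m), T.card ≤ d ∧ f.value r = f.value (UnivAlg.restrictTo z r T) :=
  ⟨fun ⟨_, hn⟩ => hn.exists_card_le z,
    fun ⟨d, _, hd⟩ => ⟨d, UnivAlg.supernilpotentOfDegree_of_exists_card_le hA hd⟩⟩
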